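/- **DMT of the gateway channel: opportunistic access with full CSI, with one-bit feedback, and access without transmit CSI.** Let $M\ge 1$ source-destination pairs communicate through one half-duplex decode-and-forward relay, with no direct links and no buffering; each hop uses half of the transmission interval. The coefficients $h_{ir}$ (source $i$ to relay) and $h_{ri}$ (relay to destination $i$), $1\le i\le M$, are $2M$ independent $\mathcal{CN}(0,v)$ random variables, $v>0$; all noises have unit variance and each transmitter has power (SNR) $\rho$. Put $\gamma_i=\min(|h_{ir}|^2,|h_{ri}|^2)$. Let $R(\rho)$ be the total rate, with multiplexing gain $r=\lim_{\rho\to\infty}R(\rho)/\log_2\rho$, and suppose $R(\rho)\ge c$ for some $c>0$ and all large $\rho$ (automatic if $r>0$). The diversity gain of a scheme with outage probability $P_{\mathcal O}(\rho)$ is $-\lim_{\rho\to\infty}\log P_{\mathcal O}(\rho)/\log\rho$; as usual for long codewords, errors are measured by outage. In opportunistic access one pair is selected in each transmission interval and attempts the rate $R(\rho)$; it is in outage if $R>\frac12\log_2(1+\rho\gamma_i)$ for the selected pair $i$. Then: 1. (Upper bound.) For every way of selecting one pair as a function of $\rho$ and of the channel state (and of other randomness), the diversity gain is at most $M(1-2r)^+$,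 i.e. $\limsup_{\rho\to\infty}\bigl(-\log P_{\mathcal O}(\rho)/\log\rho\bigr)\le M(1-2r)^+$. 2. (Full CSI.) If the relay selects a pair $i^*\in\arg\max_i\gamma_i$, the diversity gain equals $d(r)=M(1-2r)^+$, the upper bound. 3. (One-bit feedback.) Let each destination send one bit, which is $1$ iff $|h_{ri}|^2\ge\alpha$ with $\alpha=(2^{2R}-1)/\rho$ (that is, $\alpha=(\rho^{2r}-1)/\rho$ for $R=r\log_2\rho$). Let the relay, knowing only these bits and its incoming coefficients $h_{ir}$ (and possibly a random seed), select among the pairs whose bit is $1$ one with the largest $|h_{ir}|^2$, or else any (for instance a random) pair whose bit is $1$ and whose source-relay link supports $R$, whenever such a pair exists. Then the diversity gain is again $d(r)=M(1-2r)^+$. 4. (No transmit CSI.) Let instead all $M$ pairs be served in every interval, each with rate $R/M$. The network is in outage if one or more users cannot support the rate $R/M$ on the multiple-access side or on the broadcast side. On the multiple-access side the supported rates are $\sum_{i\in S}R_i\le\frac12\log_2(1+\rho\sum_{i\in S}|h_{ir}|^2)$ for all $S\subseteq\{1,\dots,M\}$ (superposition), or $R_i\le\frac1{2M}\log_2(1+\rho|h_{ir}|^2)$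 for all $i$ (orthogonal access). With orthogonal transmission on the broadcast side, where the supported rates are $R_i\le\frac1{2M}\log_2(1+\rho|h_{ri}|^2)$ for all $i$, and with either kind of multiple access, the diversity gain is exactly $d(r)=(1-2r)^+$. No other broadcast strategy does better: if the relay uses superposition of independent Gaussian codebooks, one per message, with a power allocation that does not depend on the channel state and has average power at most $\rho$, time-shared over finitely many phases, each destination jointly decoding some set of messages containing its own and treating the rest as noise, then, with either kind of multiple access, $\limsup_{\rho\to\infty}\bigl(-\log P_{\mathcal O}(\rho)/\log\rho\bigr)\le(1-2r)^+$. -/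

import Mathlib

open Filter Topology MeasureTheory ProbabilityTheory
open scoped NNReal

namespace Gateway

noncomputable section

/-! ### Diversity and multiplexing gain -/

/-- The rate `R(ρ)` (in bits per channel use) has multiplexing gain `r`, that is
`R(ρ) / log₂ ρ → r`. The rate is also required to stay bounded away from `0`; this is automatic
for `r > 0`, and for `r = 0` it excludes rates that vanish as the SNR grows. -/
def HasMultiplexingGain (R : ℝ → ℝ) (r : ℝ) : Prop :=
  Tendsto (fun ρ => R ρ / Real.logb 2 ρ) atTop (𝓝 r) ∧ ∃ c : ℝ, 0 < c ∧ ∀ᶠ ρ in atTop, c ≤ R ρ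

/-- The outage probability `p(ρ)` has diversity gain exactly `d = - lim log p(ρ) / log ρ`. -/
def HasDiversity (p : ℝ → ℝ) (d : ℝ) : Prop :=
  (∀ᶠ ρ in atTop, 0 < p ρ) ∧ Tendsto (fun ρ => -Real.log (p ρ) / Real.log ρ) atTop (𝓝 d)

/-- The diversity gain of the outage probability `p(ρ)` is at most `d`:
`limsup (- log p(ρ) / log ρ) ≤ d`. -/
def DiversityAtMost (p : ℝ → ℝ) (d : ℝ) : Prop :=
  (∀ᶠ ρ in atTop, 0 < p ρ) ∧
    ∀ ε : ℝ, 0 < ε → ∀ᶠ ρ in atTop, -Real.log (p ρ) / Real.log ρ ≤ d + ε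

/-! ### The fading model -/

/-- The circularly symmetric complex Gaussian law `CN(0, v)`: real and imaginary part are
independent centred real Gaussians of variance `v / 2`. -/
def complexGaussian (v : ℝ≥0) : Measure ℂ :=
  ((gaussianReal 0 (v / 2)).prod (gaussianReal 0 (v / 2))).map Complex.equivRealProd.symm

/-- The source-relay coefficients `hIn i` and the relay-destination coefficients `hOut i` of the
`M` pairs are `2 M` independent `CN(0, v)` random variables. -/
structure IsGatewayFading {Ω : Type*} [MeasurableSpace Ω] (P : Measure Ω) {M : ℕ} (v : ℝ≥0)
    (hIn hOut : Fin M → Ω → ℂ) : Prop where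
  law_in : ∀ i, HasLaw (hIn i) (complexGaussian v) P
  law_out : ∀ i, HasLaw (hOut i) (complexGaussian v) P
  indep : iIndepFun (Sum.elim hIn hOut) P

/-! ### Opportunistic access -/

/-- A hop with channel gain `g` supports the rate `R` at SNR `ρ`. The factor `1 / 2` is due to the
half-duplex relay: each hop uses half of the transmission interval. -/
def Supports (ρ R g : ℝ) : Prop :=
  R ≤ 1 / 2 * Real.logb 2 (1 + ρ * g)

/-- The effective decode-and-forward gain `γ_i = min (|h_ir|², |h_ri|²)` of pair `i`. -/
def pairGain {M : ℕ} (x y : Fin M → ℂ) (i : Fin M) : ℝ :=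
  min (‖x i‖ ^ 2) (‖y i‖ ^ 2)

/-- Outage probability at SNR `ρ` when the pair `S ω` is given the channel with rate `R`: the
probability that the gain of the selected pair does not support `R`. -/
def selectionOutage {Ω : Type*} [MeasurableSpace Ω] (P : Measure Ω) {M : ℕ}
    (hIn hOut : Fin M → Ω → ℂ) (S : Ω → Fin M) (ρ R : ℝ) : ℝ :=
  P.real {ω | ¬ Supports ρ R (pairGain (fun i => hIn i ω) (fun i => hOut i ω) (S ω))}

/-- Full CSI: `i` maximizes the effective gain over all pairs. -/
def IsBestPair {M : ℕ} (x y : Fin M → ℂ) (i : Fin M) : Prop :=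
  ∀ j, pairGain x y j ≤ pairGain x y i

/-- The threshold `α = (2 ^ (2 R) - 1) / ρ`; it is `(ρ ^ (2 r) - 1) / ρ` for `R = r log₂ ρ`. -/
def threshold (ρ R : ℝ) : ℝ :=
  ((2 : ℝ) ^ (2 * R) - 1) / ρ

open Classical in
/-- The bits reported by the destinations: each compares its own incoming gain with `α`. -/
def feedback {M : ℕ} (α : ℝ) (y : Fin M → ℂ) (i : Fin M) : Bool :=
  decide (α ≤ ‖y i‖ ^ 2)

/-- A relay rule under one-bit feedback. The relay sees the `M` reported bits, its incoming
coefficients, and possibly a random seed (for random choices), and picks a pair. -/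
abbrev RelayRule (M : ℕ) (Θ : Type*) := (Fin M → Bool) → (Fin M → ℂ) → Θ → Fin M

/-- Whenever some destination reports `1`, the rule picks, among the pairs whose destination
reports `1`, one with the best source-relay channel. -/
def RelayRule.PicksBestEligible {M : ℕ} {Θ : Type*} (f : RelayRule M Θ) : Prop :=
  ∀ (b : Fin M → Bool) (x : Fin M → ℂ) (θ : Θ), (∃ i, b i = true) →
    b (f b x θ) = true ∧ ∀ i, b i = true → ‖x i‖ ^ 2 ≤ ‖x (f b x θ)‖ ^ 2

/-- Whenever the relay detects a pair whose destination reports `1` and whose source-relay link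
supports the rate, the rule picks (arbitrarily or at random) one such pair. -/
def RelayRule.PicksSupported {M : ℕ} {Θ : Type*} (f : RelayRule M Θ) (ρ R : ℝ) : Prop :=
  ∀ (b : Fin M → Bool) (x : Fin M → ℂ) (θ : Θ),
    (∃ i, b i = true ∧ Supports ρ R (‖x i‖ ^ 2)) →
    b (f b x θ) = true ∧ Supports ρ R (‖x (f b x θ)‖ ^ 2)

/-- Outage probability of the one-bit feedback scheme with relay rule `f` and seed `U`. -/
def oneBitOutage {Ω : Type*} [MeasurableSpace Ω] (P : Measure Ω) {M : ℕ} {Θ : Type*}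
    (hIn hOut : Fin M → Ω → ℂ) (U : Ω → Θ) (f : RelayRule M Θ) (ρ R : ℝ) : ℝ :=
  selectionOutage P hIn hOut
    (fun ω => f (feedback (threshold ρ R) (fun i => hOut i ω)) (fun i => hIn i ω) (U ω)) ρ R

/-! ### No transmit CSI

All `M` pairs are served in every transmission interval, each with rate `R / M`. -/

/-- Channel access of the sources on the multiple-access side. -/
inductive Access
  | superposition
  | orthogonal

/-- The rate vector `q` lies in the multiple-access region for source-relay coefficients `x`, each
source having power `ρ`. -/
def MACSupports {M : ℕ} (ρ : ℝ) (x : Fin M → ℂ) (q : Fin M → ℝ) : Access → Prop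
  | .superposition => ∀ T : Finset (Fin M),
      ∑ i ∈ T, q i ≤ 1 / 2 * Real.logb 2 (1 + ∑ i ∈ T, ‖x i‖ ^ 2 * ρ)
  | .orthogonal => ∀ i, q i ≤ 1 / (2 * (M : ℝ)) * Real.logb 2 (1 + ρ * ‖x i‖ ^ 2)

/-- The rate vector `q` lies in the orthogonal (time-sharing) broadcast region for
relay-destination coefficients `y`. -/
def orthogonalBCSupports {M : ℕ} (ρ : ℝ) (y : Fin M → ℂ) (q : Fin M → ℝ) : Prop :=
  ∀ i, q i ≤ 1 / (2 * (M : ℝ)) * Real.logb 2 (1 + ρ * ‖y i‖ ^ 2)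

/-- A transmission strategy of the relay that does not use the channel state: superposition of one
Gaussian codebook per message, with a fixed power allocation, time-shared over finitely many
phases. Phase `k` has duration fraction `frac k` and spends power `power k i` on message `i`.
Orthogonal transmission has `M` phases with fraction `1 / M`, phase `k` spending all of its power
on message `k`; pure superposition coding has one phase. -/
structure BroadcastStrategy (M : ℕ) where
  phases : ℕ
  frac : Fin phases → ℝ
  power : Fin phases → Fin M → ℝ
  frac_nonneg : ∀ k, 0 ≤ frac k
  frac_sum : ∑ k, frac k = 1
  power_nonneg : ∀ k i, 0 ≤ power k i

/-- Average power spent by the relay. -/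
def BroadcastStrategy.avgPower {M : ℕ} (B : BroadcastStrategy M) : ℝ :=
  ∑ k, B.frac k * ∑ i, B.power k i

/-- A destination with gain `g` recovers message `j` when the messages have rates `q`: it jointly
decodes the messages of some set `D` containing `j` and treats all others as noise. -/
def BroadcastStrategy.Decodes {M : ℕ} (B : BroadcastStrategy M) (q : Fin M → ℝ) (g : ℝ)
    (j : Fin M) : Prop :=
  ∃ D : Finset (Fin M), j ∈ D ∧ ∀ T ⊆ D,
    ∑ i ∈ T, q i ≤ 1 / 2 * ∑ k, B.frac k *
      Real.logb 2 (1 + (g * ∑ i ∈ T, B.power k i) / (1 + g * ∑ i ∈ Dᶜ, B.power k i))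

/-- Every destination recovers its own message. -/
def BroadcastStrategy.BCSupports {M : ℕ} (B : BroadcastStrategy M) (y : Fin M → ℂ)
    (q : Fin M → ℝ) : Prop :=
  ∀ j, B.Decodes q (‖y j‖ ^ 2) j

/-- Outage probability of the network without transmit CSI, sum rate `R`, access `a` on the
multiple-access side, and `bc y q` stating that the rates `q` are supported on the broadcast side
for coefficients `y`: the probability that one or more of the users cannot support the rate
`R / M` on at least one of the two sides. -/
def noCSIOutage {Ω : Type*} [MeasurableSpace Ω] (P : Measure Ω) {M : ℕ}
    (hIn hOut : Fin M → Ω → ℂ) (a : Access) (bc : (Fin M → ℂ) → (Fin M → ℝ) → Prop)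
    (ρ R : ℝ) : ℝ :=
  P.real {ω | ¬ MACSupports ρ (fun i => hIn i ω) (fun _ => R / M) a ∨
    ¬ bc (fun i => hOut i ω) (fun _ => R / M)}

end

end Gateway

/-!
For large `ρ`, a hop with gain `g` supports `R` exactly if `g` is at least the threshold
`τ = (2 ^ (2 R) - 1) / ρ`. Since `R` has multiplexing gain `r` and stays away from `0`,
`log τ / log ρ → 2 r - 1`. The law `CN(0, v)` has a density on `ℂ` which is bounded, and bounded
below near `0`, so `F(t) = P(|h|² < t)` agrees with `min (t / v) 1` up to constant factors. Hence
`F(s τ)` has diversity `(1 - 2 r)⁺` for every constant `s > 0`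
(`HasMultiplexingGain.hasDiversity_norm_sq_lt`), and everything reduces to bounding outage
probabilities by constant multiples of powers of `F(s τ)`.

*Opportunistic access.* If all source-relay links are below `τ`, every selection fails, so the
outage probability is at least `F(τ) ^ M`. The selections with full CSI and with one-bit feedback
fail only if every pair has a link below `τ`. By a union bound over the `2 ^ M` ways to choose one
bad link per pair, this has probability at most `2 ^ M F(τ) ^ M`.

*No transmit CSI.* With orthogonal broadcast, a single relay-destination link below `τ` causes an
outage, and conversely an outage needs one of the `2 M` links to be below `τ`: the outage
probability is between `F(τ)` and `2 M F(τ)`. For a general broadcast strategy, suppose a receiver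
with gain `g < τ` could recover every message. Chaining its joint decoding steps would yield a sum
rate of at most `log₂ (1 + ρ g) / 2 < R` (`BroadcastStrategy.sum_rate_le`), a contradiction. As the
strategy does not know the channel, some user, determined by `ρ` alone, fails whenever its own gain
is below `τ / 2` (`BroadcastStrategy.exists_not_decodes`), which has probability `F(τ / 2)`.
-/

namespace Gateway

/-! ### The channel gain near zero -/

/-- `CN(0, v)` has the density `exp (-|z|² / v) / (π v)` on `ℂ`. -/
theorem complexGaussian_apply {v : ℝ≥0} (hv : v ≠ 0) {s : Set ℂ} (hs : MeasurableSet s) :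
    complexGaussian v s =
      ∫⁻ z in s, ENNReal.ofReal ((Real.pi * v)⁻¹ * Real.exp (-‖z‖ ^ 2 / v)) := by
  have hv2 : v / 2 ≠ 0 := by positivity
  have hm : Measurable fun z : ℂ =>
      ENNReal.ofReal ((Real.pi * v)⁻¹ * Real.exp (-‖z‖ ^ 2 / v)) := by fun_prop
  have hpre : MeasurableSet (Complex.equivRealProd.symm ⁻¹' s) :=
    Complex.measurableEquivRealProd.symm.measurable hs
  rw [complexGaussian, Measure.map_apply (f := Complex.equivRealProd.symm)
      Complex.measurableEquivRealProd.symm.measurable hs,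
    gaussianReal_of_var_ne_zero _ hv2,
    prod_withDensity (measurable_gaussianPDF _ _) (measurable_gaussianPDF _ _),
    ← Measure.volume_eq_prod, withDensity_apply _ hpre,
    ← (Complex.volume_preserving_equiv_real_prod.symm).setLIntegral_comp_preimage hs hm]
  refine setLIntegral_congr_fun hpre fun p _ => ?_
  simp only [gaussianPDF, gaussianPDFReal]
  rw [← ENNReal.ofReal_mul (by positivity)]
  congr 1
  have h1 : ‖Complex.measurableEquivRealProd.symm p‖ ^ 2 = p.1 ^ 2 + p.2 ^ 2 := by
    rw [← Complex.normSq_eq_norm_sq, Complex.normSq_apply]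
    simp [Complex.measurableEquivRealProd]
    ring
  have hv0 : (0 : ℝ) < v := by positivity
  have h2 : (2 * Real.pi * ((v / 2 : ℝ≥0) : ℝ)) = Real.pi * v := by push_cast; ring
  rw [h1, h2, mul_mul_mul_comm, ← Real.exp_add, ← mul_inv, Real.mul_self_sqrt (by positivity)]
  congr 2
  push_cast
  field_simp
  ring

theorem setOf_norm_sq_lt (t : ℝ) : {z : ℂ | ‖z‖ ^ 2 < t} = Metric.ball 0 (√t) := by
  ext z
  simp [Real.lt_sqrt (norm_nonneg z)]

theorem volume_norm_sq_lt {t : ℝ} (ht : 0 ≤ t) :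
    volume {z : ℂ | ‖z‖ ^ 2 < t} = ENNReal.ofReal (Real.pi * t) := by
  rw [setOf_norm_sq_lt, Complex.volume_ball, ← ENNReal.ofReal_pow (Real.sqrt_nonneg t),
    Real.sq_sqrt ht, mul_comm, ENNReal.ofReal_mul Real.pi_nonneg]
  congr 1
  rw [← NNReal.coe_real_pi, ENNReal.ofReal_coe_nnreal]

theorem measurableSet_norm_sq_lt (t : ℝ) : MeasurableSet {z : ℂ | ‖z‖ ^ 2 < t} := by
  rw [setOf_norm_sq_lt]
  exact measurableSet_ball

instance (v : ℝ≥0) : IsProbabilityMeasure (complexGaussian v) :=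
  Measure.isProbabilityMeasure_map
    Complex.measurableEquivRealProd.symm.measurable.aemeasurable

/-- The density of `CN(0, v)` is at most `1 / (π v)`. -/
theorem complexGaussian_norm_sq_lt_le {v : ℝ≥0} (hv : 0 < v) {t : ℝ} (ht : 0 ≤ t) :
    (complexGaussian v).real {z | ‖z‖ ^ 2 < t} ≤ min (t / v) 1 := by
  have hv0 : (0 : ℝ) < v := hv
  refine le_min ?_ measureReal_le_one
  refine ENNReal.toReal_le_of_le_ofReal (by positivity) ?_
  rw [complexGaussian_apply hv.ne' (measurableSet_norm_sq_lt t)]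
  calc _ ≤ ∫⁻ _ in {z : ℂ | ‖z‖ ^ 2 < t}, ENNReal.ofReal (Real.pi * v)⁻¹ := by
        refine lintegral_mono fun z => ENNReal.ofReal_le_ofReal ?_
        refine mul_le_of_le_one_right (by positivity) (Real.exp_le_one_iff.2 ?_)
        rw [neg_div]
        exact neg_nonpos.2 (by positivity)
    _ = ENNReal.ofReal (t / v) := by
        rw [setLIntegral_const, volume_norm_sq_lt ht, ← ENNReal.ofReal_mul (by positivity)]
        congr 1
        field_simp

/-- On the disc `|z|² < v` the density of `CN(0, v)` is at least `e⁻¹ / (π v)`. -/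
theorem le_complexGaussian_norm_sq_lt {v : ℝ≥0} (hv : 0 < v) {t : ℝ} (ht : 0 ≤ t) :
    Real.exp (-1) * min (t / v) 1 ≤ (complexGaussian v).real {z | ‖z‖ ^ 2 < t} := by
  have hv0 : (0 : ℝ) < v := hv
  set s : ℝ := min t v with hs
  have hs0 : 0 ≤ s := le_min ht hv0.le
  have hmin : min (t / v) 1 = s / v := by
    rw [hs, ← min_div_div_right hv0.le, div_self hv0.ne']
  rw [hmin]
  refine le_trans ?_ (measureReal_mono (s₁ := {z : ℂ | ‖z‖ ^ 2 < s})
    fun z (hz : ‖z‖ ^ 2 < s) => lt_of_lt_of_le hz (min_le_left _ _))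
  refine (ENNReal.ofReal_le_iff_le_toReal (measure_ne_top _ _)).1 ?_
  rw [complexGaussian_apply hv.ne' (measurableSet_norm_sq_lt s)]
  calc ENNReal.ofReal (Real.exp (-1) * (s / v))
      = ∫⁻ _ in {z : ℂ | ‖z‖ ^ 2 < s},
          ENNReal.ofReal ((Real.pi * v)⁻¹ * Real.exp (-1)) := by
        rw [setLIntegral_const, volume_norm_sq_lt hs0, ← ENNReal.ofReal_mul (by positivity)]
        congr 1
        field_simp
    _ ≤ _ := by
        refine setLIntegral_mono' (measurableSet_norm_sq_lt s) fun z hz => ?_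
        refine ENNReal.ofReal_le_ofReal ?_
        have hz' : ‖z‖ ^ 2 ≤ v := (le_of_lt hz).trans (min_le_right _ _)
        gcongr
        rw [neg_div, neg_le_neg_iff, div_le_one hv0]
        exact hz'

/-! ### Independent fading -/

section Fading

variable {Ω : Type*} [MeasurableSpace Ω] {P : Measure Ω} {M : ℕ} {v : ℝ≥0}
  {hIn hOut : Fin M → Ω → ℂ}

theorem IsGatewayFading.law (h : IsGatewayFading P v hIn hOut) (i : Fin M ⊕ Fin M) :
    HasLaw (Sum.elim hIn hOut i) (complexGaussian v) P := by
  cases i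
  · exact h.law_in _
  · exact h.law_out _

/-- Any `k` of the `2 M` channel gains are all smaller than `t` with probability
`P(|h|² < t) ^ k`. -/
theorem IsGatewayFading.measureReal_forall_lt (h : IsGatewayFading P v hIn hOut)
    (A : Finset (Fin M ⊕ Fin M)) (t : ℝ) :
    P.real {ω | ∀ i ∈ A, ‖Sum.elim hIn hOut i ω‖ ^ 2 < t} =
      (complexGaussian v).real {z | ‖z‖ ^ 2 < t} ^ A.card := by
  have h1 : {ω | ∀ i ∈ A, ‖Sum.elim hIn hOut i ω‖ ^ 2 < t} =
      ⋂ i ∈ A, Sum.elim hIn hOut i ⁻¹' {z | ‖z‖ ^ 2 < t} := by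
    ext ω; simp
  have h2 : ∀ i, P (Sum.elim hIn hOut i ⁻¹' {z | ‖z‖ ^ 2 < t}) =
      complexGaussian v {z | ‖z‖ ^ 2 < t} := fun i =>
    (h.law i).measure_eq (measurableSet_norm_sq_lt t)
  rw [measureReal_def, h1, h.indep.measure_inter_preimage_eq_mul A
    (sets := fun _ => {z | ‖z‖ ^ 2 < t}) fun _ _ => measurableSet_norm_sq_lt t]
  simp_rw [h2, Finset.prod_const, ENNReal.toReal_pow, measureReal_def]

theorem IsGatewayFading.measureReal_lt (h : IsGatewayFading P v hIn hOut)
    (i : Fin M ⊕ Fin M) (t : ℝ) :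
    P.real {ω | ‖Sum.elim hIn hOut i ω‖ ^ 2 < t} =
      (complexGaussian v).real {z | ‖z‖ ^ 2 < t} := by
  simpa using h.measureReal_forall_lt {i} t

/-- All pairs are bad with probability at least that of all source-relay links being bad. -/
theorem IsGatewayFading.le_measureReal_pairGain_lt [IsProbabilityMeasure P]
    (h : IsGatewayFading P v hIn hOut) (t : ℝ) :
    (complexGaussian v).real {z | ‖z‖ ^ 2 < t} ^ M ≤
      P.real {ω | ∀ i, pairGain (fun i => hIn i ω) (fun i => hOut i ω) i < t} := by
  have := h.measureReal_forall_lt (Finset.univ.map Function.Embedding.inl) t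
  rw [Finset.card_map, Finset.card_univ, Fintype.card_fin] at this
  rw [← this]
  refine measureReal_mono fun ω hω i => ?_
  exact min_lt_of_left_lt (hω (Sum.inl i) (by simp))

/-- If all pairs are bad, then for some set `A` of pairs the source-relay links of the pairs in
`A` and the relay-destination links of the other pairs are bad: `M` independent links. -/
theorem IsGatewayFading.measureReal_pairGain_lt_le [IsProbabilityMeasure P]
    (h : IsGatewayFading P v hIn hOut) (t : ℝ) :
    P.real {ω | ∀ i, pairGain (fun i => hIn i ω) (fun i => hOut i ω) i < t} ≤
      2 ^ M * (complexGaussian v).real {z | ‖z‖ ^ 2 < t} ^ M := by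
  classical
  have hsub : {ω | ∀ i, pairGain (fun i => hIn i ω) (fun i => hOut i ω) i < t} ⊆
      ⋃ A : Finset (Fin M), {ω | ∀ i ∈ A.disjSum Aᶜ, ‖Sum.elim hIn hOut i ω‖ ^ 2 < t} := by
    intro ω hω
    refine Set.mem_iUnion.2 ⟨Finset.univ.filter fun i => ‖hIn i ω‖ ^ 2 < t, ?_⟩
    rintro (i | i) hi
    · simpa using hi
    · have hi' : t ≤ ‖hIn i ω‖ ^ 2 := by simpa using hi
      exact (min_lt_iff.1 (hω i)).resolve_left hi'.not_gt
  refine (measureReal_mono hsub).trans ((measureReal_iUnion_fintype_le _).trans_eq ?_)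
  simp_rw [h.measureReal_forall_lt, Finset.card_disjSum, Finset.card_add_card_compl]
  simp

theorem IsGatewayFading.measureReal_exists_pairGain_lt_le [IsProbabilityMeasure P]
    (h : IsGatewayFading P v hIn hOut) (t : ℝ) :
    P.real {ω | ∃ i, pairGain (fun i => hIn i ω) (fun i => hOut i ω) i < t} ≤
      2 * M * (complexGaussian v).real {z | ‖z‖ ^ 2 < t} := by
  have hsub : {ω | ∃ i, pairGain (fun i => hIn i ω) (fun i => hOut i ω) i < t} ⊆
      ⋃ i : Fin M ⊕ Fin M, {ω | ‖Sum.elim hIn hOut i ω‖ ^ 2 < t} := by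
    rintro ω ⟨i, hi⟩
    rcases min_lt_iff.1 hi with hi | hi
    · exact Set.mem_iUnion.2 ⟨Sum.inl i, hi⟩
    · exact Set.mem_iUnion.2 ⟨Sum.inr i, hi⟩
  refine (measureReal_mono hsub).trans ((measureReal_iUnion_fintype_le _).trans_eq ?_)
  simp_rw [h.measureReal_lt]
  simp [two_mul]

end Fading

/-! ### Rates and thresholds -/

theorem supports_iff {ρ R g : ℝ} (hρ : 0 < ρ) (hg : 0 ≤ g) :
    Supports ρ R g ↔ threshold ρ R ≤ g := by
  rw [Supports, threshold, div_le_iff₀ hρ, sub_le_iff_le_add, mul_comm g, add_comm _ (1 : ℝ),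
    ← Real.le_logb_iff_rpow_le one_lt_two (by positivity)]
  constructor <;> intro h <;> linarith

theorem not_supports_pairGain_iff {M : ℕ} {ρ R : ℝ} (hρ : 0 < ρ) (x y : Fin M → ℂ) (i : Fin M) :
    ¬ Supports ρ R (pairGain x y i) ↔ pairGain x y i < threshold ρ R := by
  have h0 : 0 ≤ pairGain x y i := le_min (by positivity) (by positivity)
  rw [supports_iff hρ h0, not_le]

theorem le_orthogonal_rate_iff {M : ℕ} (hM : 1 ≤ M) (ρ R g : ℝ) :
    R / M ≤ 1 / (2 * (M : ℝ)) * Real.logb 2 (1 + ρ * g) ↔ Supports ρ R g := by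
  have hM0 : (0 : ℝ) < M := by exact_mod_cast hM
  rw [Supports, div_le_iff₀ hM0]
  have : 1 / (2 * (M : ℝ)) * Real.logb 2 (1 + ρ * g) * M = 1 / 2 * Real.logb 2 (1 + ρ * g) := by
    field_simp
  rw [this]

theorem threshold_pos {ρ R : ℝ} (hρ : 0 < ρ) (hR : 0 < R) : 0 < threshold ρ R := by
  refine div_pos (sub_pos.2 ?_) hρ
  exact Real.one_lt_rpow one_lt_two (by positivity)

/-- The multiple-access side supports the symmetric rate `R / M` as soon as every source-relay
link supports `R` alone. With superposition, `T` users need only `|T| R / M ≤ R` in total. -/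
theorem macSupports_of_forall_threshold_le {M : ℕ} (hM : 1 ≤ M) {ρ R : ℝ} (hρ : 0 < ρ)
    (hR : 0 ≤ R) {x : Fin M → ℂ} (hx : ∀ i, threshold ρ R ≤ ‖x i‖ ^ 2) (a : Access) :
    MACSupports ρ x (fun _ => R / M) a := by
  have hs : ∀ i, Supports ρ R (‖x i‖ ^ 2) := fun i =>
    (supports_iff hρ (by positivity)).2 (hx i)
  cases a with
  | orthogonal => exact fun i => (le_orthogonal_rate_iff hM _ _ _).2 (hs i)
  | superposition =>
    intro T
    rcases T.eq_empty_or_nonempty with rfl | ⟨i, hi⟩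
    · simp
    have hM0 : (0 : ℝ) < M := by exact_mod_cast hM
    calc ∑ _ ∈ T, R / M = T.card * (R / M) := by simp
      _ ≤ M * (R / M) := by
        gcongr
        simpa using Finset.card_le_univ T
      _ = R := by field_simp
      _ ≤ 1 / 2 * Real.logb 2 (1 + ρ * ‖x i‖ ^ 2) := hs i
      _ ≤ _ := by
        have : ‖x i‖ ^ 2 * ρ ≤ ∑ i ∈ T, ‖x i‖ ^ 2 * ρ :=
          Finset.single_le_sum (f := fun i => ‖x i‖ ^ 2 * ρ) (fun _ _ => by positivity) hi
        gcongr
        · exact one_lt_two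
        · linarith

/-! ### Broadcast strategies that do not know the channel -/

namespace BroadcastStrategy

variable {M : ℕ} (B : BroadcastStrategy M)

theorem sum_power_nonneg (k : Fin B.phases) (T : Finset (Fin M)) : 0 ≤ ∑ i ∈ T, B.power k i :=
  Finset.sum_nonneg fun _ _ => B.power_nonneg _ _

/-- A better channel decodes at least as much: the SINR increases with the gain. -/
theorem Decodes.mono {B : BroadcastStrategy M} {q : Fin M → ℝ} {g g' : ℝ} {j : Fin M}
    (h : B.Decodes q g j) (hg : 0 ≤ g) (hgg' : g ≤ g') : B.Decodes q g' j := by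
  obtain ⟨D, hj, hD⟩ := h
  refine ⟨D, hj, fun T hT => (hD T hT).trans ?_⟩
  refine mul_le_mul_of_nonneg_left (Finset.sum_le_sum fun k _ => ?_) (by norm_num)
  refine mul_le_mul_of_nonneg_left ?_ (B.frac_nonneg k)
  have hg' := hg.trans hgg'
  have ha := B.sum_power_nonneg k T
  have hb := B.sum_power_nonneg k Dᶜ
  refine Real.logb_le_logb_of_le one_lt_two (by positivity) (add_le_add_right ?_ 1)
  rw [div_le_div_iff₀ (by positivity) (by positivity)]
  nlinarith [mul_le_mul_of_nonneg_right hgg' ha]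

/-- If a receiver with gain `g` recovers each message of a set `s`, then the messages of some
`E ⊇ s` satisfy a joint sum-rate bound, the remaining messages being noise. Removing the signals
of the messages decoded so far turns the bound for one decoding set after the other into a
telescoping sum. -/
theorem exists_superset_sum_rate_le {q : Fin M → ℝ} {g : ℝ} (hg : 0 ≤ g) (s : Finset (Fin M))
    (h : ∀ j ∈ s, B.Decodes q g j) :
    ∃ E : Finset (Fin M), s ⊆ E ∧ ∑ i ∈ E, q i ≤ 1 / 2 * ∑ k, B.frac k *
      (Real.logb 2 (1 + g * ∑ i, B.power k i) - Real.logb 2 (1 + g * ∑ i ∈ Eᶜ, B.power k i)) := by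
  induction s using Finset.induction_on with
  | empty => exact ⟨∅, by simp, by simp⟩
  | insert j s _ ih =>
    obtain ⟨E, hsE, hE⟩ := ih fun i hi => h i (Finset.mem_insert_of_mem hi)
    obtain ⟨D, hjD, hD⟩ := h j (Finset.mem_insert_self _ _)
    refine ⟨E ∪ D, Finset.insert_subset (Finset.mem_union_right _ hjD)
      (hsE.trans Finset.subset_union_left), ?_⟩
    have hT := hD (D \ E) Finset.sdiff_subset
    have hsum : ∑ i ∈ E ∪ D, q i = ∑ i ∈ E, q i + ∑ i ∈ D \ E, q i := by
      rw [← Finset.union_sdiff_self_eq_union, Finset.sum_union Finset.disjoint_sdiff]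
    rw [hsum]
    refine (add_le_add hE hT).trans ?_
    rw [← mul_add, ← Finset.sum_add_distrib]
    gcongr with k
    rw [← mul_add]
    refine mul_le_mul_of_nonneg_left ?_ (B.frac_nonneg k)
    have hT0 := B.sum_power_nonneg k (D \ E)
    have hD0 := B.sum_power_nonneg k Dᶜ
    have hU0 := B.sum_power_nonneg k (E ∪ D)ᶜ
    have hUD : ∑ i ∈ (E ∪ D)ᶜ, B.power k i ≤ ∑ i ∈ Dᶜ, B.power k i :=
      Finset.sum_le_sum_of_subset_of_nonneg
        (Finset.compl_subset_compl.2 Finset.subset_union_right) fun _ _ _ => B.power_nonneg _ _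
    have hEc : ∑ i ∈ Eᶜ, B.power k i =
        ∑ i ∈ D \ E, B.power k i + ∑ i ∈ (E ∪ D)ᶜ, B.power k i := by
      rw [← Finset.sum_union]
      · congr 1
        ext i
        simp only [Finset.mem_compl, Finset.mem_union, Finset.mem_sdiff]
        tauto
      · rw [Finset.disjoint_left]
        intro i hi hi'
        simp_all
    have key : Real.logb 2 (1 + (g * ∑ i ∈ D \ E, B.power k i) / (1 + g * ∑ i ∈ Dᶜ, B.power k i)) ≤
        Real.logb 2 (1 + g * ∑ i ∈ Eᶜ, B.power k i) -
          Real.logb 2 (1 + g * ∑ i ∈ (E ∪ D)ᶜ, B.power k i) := by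
      rw [← Real.logb_div (by rw [hEc]; positivity) (by positivity), hEc]
      refine Real.logb_le_logb_of_le one_lt_two (by positivity) ?_
      calc _ ≤ 1 + (g * ∑ i ∈ D \ E, B.power k i) / (1 + g * ∑ i ∈ (E ∪ D)ᶜ, B.power k i) := by
            gcongr
        _ = _ := by
            field_simp
            ring
    linarith

/-- If a receiver with gain `g` recovers all messages, the sum rate is at most the capacity of a
single link with gain `g` and power `ρ`. Time sharing does not help, by concavity of `log`. -/
theorem sum_rate_le {q : Fin M → ℝ} {g ρ : ℝ} (hg : 0 ≤ g) (hB : B.avgPower ≤ ρ)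
    (h : ∀ j, B.Decodes q g j) : Supports ρ (∑ i, q i) g := by
  obtain ⟨E, hE, hq⟩ := B.exists_superset_sum_rate_le hg Finset.univ fun j _ => h j
  obtain rfl := Finset.univ_subset_iff.1 hE
  simp only [Finset.compl_univ, Finset.sum_empty, mul_zero, add_zero, Real.logb_one,
    sub_zero] at hq
  refine hq.trans ?_
  have hj := strictConcaveOn_log_Ioi.concaveOn.le_map_sum (t := Finset.univ) (w := B.frac)
    (p := fun k => 1 + g * ∑ i, B.power k i) (fun k _ => B.frac_nonneg k) B.frac_sum
    (fun k _ => by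
      have := B.sum_power_nonneg k Finset.univ
      exact Set.mem_Ioi.2 (by positivity))
  have havg : ∑ k, B.frac k * (1 + g * ∑ i, B.power k i) = 1 + g * B.avgPower := by
    simp only [mul_add, mul_one, Finset.sum_add_distrib, B.frac_sum, avgPower, Finset.mul_sum]
    simp only [mul_left_comm]
  simp only [smul_eq_mul] at hj
  rw [havg] at hj
  have hA : 0 ≤ B.avgPower :=
    Finset.sum_nonneg fun k _ => mul_nonneg (B.frac_nonneg k) (B.sum_power_nonneg k _)
  have hlog : Real.log (1 + g * B.avgPower) ≤ Real.log (1 + ρ * g) := by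
    refine Real.log_le_log (by positivity) ?_
    nlinarith
  have h2 : 0 < Real.log 2 := Real.log_pos one_lt_two
  simp only [Real.logb, ← mul_div_assoc, ← Finset.sum_div]
  gcongr
  simpa using hj.trans hlog

/-- Whatever the strategy, for a gain `g` below the threshold of the sum rate there is a user who
cannot recover its message with gain at most `g`. The user depends on the strategy, not on the
channel. -/
theorem exists_not_decodes (hM : 1 ≤ M) {ρ R g : ℝ} (hρ : 0 < ρ) (hB : B.avgPower ≤ ρ)
    (hg : 0 ≤ g) (hgt : g < threshold ρ R) :
    ∃ j, ∀ g', 0 ≤ g' → g' ≤ g → ¬ B.Decodes (fun _ => R / M) g' j := by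
  by_contra! hcon
  have hdec : ∀ j, B.Decodes (fun _ => R / M) g j := fun j => by
    obtain ⟨g', h0, hle, hd⟩ := hcon j
    exact hd.mono h0 hle
  have hsup := B.sum_rate_le hg hB hdec
  have hM0 : (M : ℝ) ≠ 0 := by positivity
  have hR : ∑ _ : Fin M, R / M = R := by
    simp only [Finset.sum_const, Finset.card_univ, Fintype.card_fin, nsmul_eq_mul]
    field_simp
  rw [hR, supports_iff hρ hg] at hsup
  exact hgt.not_ge hsup

end BroadcastStrategy

/-! ### Calculus of diversity gains -/

theorem eventually_log_pos : ∀ᶠ ρ : ℝ in atTop, 0 < Real.log ρ :=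
  Real.tendsto_log_atTop.eventually_gt_atTop 0

theorem HasDiversity.const_mul_pow {p : ℝ → ℝ} {d c : ℝ} (h : HasDiversity p d) (hc : 0 < c)
    (k : ℕ) : HasDiversity (fun ρ => c * p ρ ^ k) (k * d) := by
  refine ⟨h.1.mono fun ρ hρ => by positivity, ?_⟩
  have h1 : Tendsto (fun ρ => -Real.log c / Real.log ρ) atTop (𝓝 0) :=
    Real.tendsto_log_atTop.const_div_atTop _
  have h2 := h1.add (h.2.const_mul (k : ℝ))
  rw [zero_add] at h2
  refine h2.congr' ?_
  filter_upwards [h.1] with ρ hρ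
  rw [Real.log_mul hc.ne' (pow_pos hρ k).ne', Real.log_pow]
  ring

theorem HasDiversity.diversityAtMost_of_le {p q : ℝ → ℝ} {d : ℝ} (h : HasDiversity p d)
    (hpq : ∀ᶠ ρ in atTop, p ρ ≤ q ρ) : DiversityAtMost q d := by
  refine ⟨?_, fun ε hε => ?_⟩
  · filter_upwards [h.1, hpq] with ρ h0 h1 using h0.trans_le h1
  · filter_upwards [h.1, hpq, eventually_log_pos,
      h.2.eventually_le_const (lt_add_of_pos_right d hε)] with ρ h0 h1 hl h2
    refine le_trans ?_ h2
    gcongr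

theorem HasDiversity.squeeze {p q p' : ℝ → ℝ} {d : ℝ} (h : HasDiversity p d)
    (h' : HasDiversity p' d) (hpq : ∀ᶠ ρ in atTop, p ρ ≤ q ρ)
    (hqp : ∀ᶠ ρ in atTop, q ρ ≤ p' ρ) : HasDiversity q d := by
  refine ⟨?_, tendsto_of_tendsto_of_tendsto_of_le_of_le' h'.2 h.2 ?_ ?_⟩
  · filter_upwards [h.1, hpq] with ρ h0 h1 using h0.trans_le h1
  · filter_upwards [h.1, hpq, hqp, eventually_log_pos] with ρ h0 h1 h2 hl
    have := h0.trans_le h1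
    gcongr
  · filter_upwards [h.1, hpq, eventually_log_pos] with ρ h0 h1 hl
    gcongr

theorem HasMultiplexingGain.eventually_pos {R : ℝ → ℝ} {r : ℝ} (hR : HasMultiplexingGain R r) :
    ∀ᶠ ρ in atTop, 0 < R ρ := by
  obtain ⟨c, hc, h⟩ := hR.2
  exact h.mono fun ρ hρ => hc.trans_le hρ

/-- The threshold behaves like `ρ ^ (2 r - 1)`. Since `R` is bounded away from `0`, the `-1` in
`2 ^ (2 R) - 1` costs only a bounded factor. -/
theorem HasMultiplexingGain.tendsto_log_threshold {R : ℝ → ℝ} {r : ℝ}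
    (hR : HasMultiplexingGain R r) :
    Tendsto (fun ρ => Real.log (threshold ρ (R ρ)) / Real.log ρ) atTop (𝓝 (2 * r - 1)) := by
  obtain ⟨c, hc, hcR⟩ := hR.2
  have hlt : ∀ x : ℝ, 0 < x → 0 < 1 - (2 : ℝ) ^ (-(2 * x)) := fun x hx =>
    sub_pos.2 (Real.rpow_lt_one_of_one_lt_of_neg one_lt_two (by linarith))
  have herr : Tendsto (fun ρ => Real.log (1 - (2 : ℝ) ^ (-(2 * R ρ))) / Real.log ρ) atTop
      (𝓝 0) := by
    have hlow : Tendsto (fun ρ => Real.log (1 - (2 : ℝ) ^ (-(2 * c))) / Real.log ρ) atTop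
        (𝓝 0) := Real.tendsto_log_atTop.const_div_atTop _
    refine tendsto_of_tendsto_of_tendsto_of_le_of_le' hlow tendsto_const_nhds ?_ ?_
    · filter_upwards [hcR, eventually_log_pos] with ρ h hl
      have := hlt c hc
      gcongr
      exact one_le_two
    · filter_upwards [hcR, eventually_log_pos] with ρ h hl
      refine div_nonpos_of_nonpos_of_nonneg (Real.log_nonpos (hlt _ (hc.trans_le h)).le ?_) hl.le
      have : (0 : ℝ) < 2 ^ (-(2 * R ρ)) := by positivity
      linarith
  have hmain := ((hR.1.const_mul 2).add herr).sub (tendsto_const_nhds (x := (1 : ℝ)))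
  rw [add_zero] at hmain
  refine hmain.congr' ?_
  filter_upwards [hcR, eventually_log_pos, eventually_gt_atTop 0] with ρ h hl hρ
  have hpos := hlt _ (hc.trans_le h)
  have heq : (2 : ℝ) ^ (2 * R ρ) - 1 = 2 ^ (2 * R ρ) * (1 - 2 ^ (-(2 * R ρ))) := by
    rw [mul_sub, mul_one, ← Real.rpow_add two_pos, add_neg_cancel, Real.rpow_zero]
  have h2 : (0 : ℝ) < 2 ^ (2 * R ρ) := by positivity
  have hl2 : Real.log 2 ≠ 0 := (Real.log_pos one_lt_two).ne'
  rw [threshold, heq, Real.log_div (mul_pos h2 hpos).ne' hρ.ne', Real.log_mul h2.ne' hpos.ne',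
    Real.log_rpow two_pos, Real.logb]
  field_simp

theorem HasMultiplexingGain.hasDiversity_min {R : ℝ → ℝ} {r w : ℝ}
    (hR : HasMultiplexingGain R r) (hw : 0 < w) :
    HasDiversity (fun ρ => min (w * threshold ρ (R ρ)) 1) (max (1 - 2 * r) 0) := by
  have hpos : ∀ᶠ ρ in atTop, 0 < threshold ρ (R ρ) := by
    filter_upwards [hR.eventually_pos, eventually_gt_atTop 0] with ρ h hρ using threshold_pos hρ h
  refine ⟨hpos.mono fun ρ h => lt_min (by positivity) one_pos, ?_⟩
  have h1 : Tendsto (fun ρ => -Real.log w / Real.log ρ) atTop (𝓝 0) :=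
    Real.tendsto_log_atTop.const_div_atTop _
  have h2 := (h1.sub hR.tendsto_log_threshold).max (tendsto_const_nhds (x := (0 : ℝ)))
  rw [zero_sub, neg_sub] at h2
  refine h2.congr' ?_
  filter_upwards [hpos, eventually_log_pos] with ρ h hl
  have hlog : Real.log (w * threshold ρ (R ρ)) = Real.log w + Real.log (threshold ρ (R ρ)) :=
    Real.log_mul hw.ne' h.ne'
  have hx : -Real.log w / Real.log ρ - Real.log (threshold ρ (R ρ)) / Real.log ρ =
      -Real.log (w * threshold ρ (R ρ)) / Real.log ρ := by
    rw [hlog]; ring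
  rw [hx]
  rcases le_total (w * threshold ρ (R ρ)) 1 with hle | hle
  · have : Real.log (w * threshold ρ (R ρ)) ≤ 0 := Real.log_nonpos (by positivity) hle
    rw [min_eq_left hle, max_eq_left (div_nonneg (neg_nonneg.2 this) hl.le)]
  · have : 0 ≤ Real.log (w * threshold ρ (R ρ)) := Real.log_nonneg hle
    rw [min_eq_right hle, Real.log_one, neg_zero, zero_div,
      max_eq_right (div_nonpos_of_nonpos_of_nonneg (neg_nonpos.2 this) hl.le)]

/-- A single channel gain is below a fixed multiple of the threshold with diversity
`(1 - 2 r)⁺`. -/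
theorem HasMultiplexingGain.hasDiversity_norm_sq_lt {R : ℝ → ℝ} {r s : ℝ} {v : ℝ≥0}
    (hR : HasMultiplexingGain R r) (hv : 0 < v) (hs : 0 < s) :
    HasDiversity (fun ρ => (complexGaussian v).real {z | ‖z‖ ^ 2 < s * threshold ρ (R ρ)})
      (max (1 - 2 * r) 0) := by
  have hv0 : (0 : ℝ) < v := hv
  have hmin := hR.hasDiversity_min (div_pos hs hv0)
  have hlow := hmin.const_mul_pow (Real.exp_pos (-1)) 1
  simp only [Nat.cast_one, one_mul, pow_one] at hlow
  have hev : ∀ᶠ ρ in atTop, 0 ≤ s * threshold ρ (R ρ) := by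
    filter_upwards [hR.eventually_pos, eventually_gt_atTop 0] with ρ h hρ
    exact (mul_pos hs (threshold_pos hρ h)).le
  refine hlow.squeeze hmin (hev.mono fun ρ h => ?_) (hev.mono fun ρ h => ?_)
  · rw [div_mul_eq_mul_div]
    exact le_complexGaussian_norm_sq_lt hv h
  · rw [div_mul_eq_mul_div]
    exact complexGaussian_norm_sq_lt_le hv h

/-! ### Opportunistic access -/

section Schemes

variable {Ω : Type*} [MeasurableSpace Ω] {P : Measure Ω} [IsProbabilityMeasure P] {M : ℕ}
  {v : ℝ≥0} {hIn hOut : Fin M → Ω → ℂ} {R : ℝ → ℝ} {r : ℝ}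

/-- If all pairs are bad, every selection is in outage. -/
theorem IsGatewayFading.le_selectionOutage (h : IsGatewayFading P v hIn hOut) (S : Ω → Fin M)
    {ρ R : ℝ} (hρ : 0 < ρ) :
    (complexGaussian v).real {z | ‖z‖ ^ 2 < threshold ρ R} ^ M ≤
      selectionOutage P hIn hOut S ρ R := by
  refine (h.le_measureReal_pairGain_lt _).trans (measureReal_mono fun ω hω => ?_)
  exact (not_supports_pairGain_iff hρ _ _ _).2 (hω _)

theorem selectionOutage_diversityAtMost (hv : 0 < v) (h : IsGatewayFading P v hIn hOut)
    (hR : HasMultiplexingGain R r) (S : ℝ → Ω → Fin M) :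
    DiversityAtMost (fun ρ => selectionOutage P hIn hOut (S ρ) ρ (R ρ))
      (M * max (1 - 2 * r) 0) := by
  have := (hR.hasDiversity_norm_sq_lt hv one_pos).const_mul_pow one_pos M
  refine this.diversityAtMost_of_le ?_
  filter_upwards [eventually_gt_atTop 0] with ρ hρ
  simpa using h.le_selectionOutage (S ρ) hρ

/-- A selection that is in outage only when all pairs are bad attains the full diversity. -/
theorem selectionOutage_hasDiversity (hv : 0 < v) (h : IsGatewayFading P v hIn hOut)
    (hR : HasMultiplexingGain R r) (S : ℝ → Ω → Fin M)
    (hS : ∀ ρ, 0 < ρ → ∀ ω, ¬ Supports ρ (R ρ)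
        (pairGain (fun i => hIn i ω) (fun i => hOut i ω) (S ρ ω)) →
      ∀ i, pairGain (fun i => hIn i ω) (fun i => hOut i ω) i < threshold ρ (R ρ)) :
    HasDiversity (fun ρ => selectionOutage P hIn hOut (S ρ) ρ (R ρ))
      (M * max (1 - 2 * r) 0) := by
  have hF := hR.hasDiversity_norm_sq_lt hv one_pos
  refine (hF.const_mul_pow one_pos M).squeeze
    (hF.const_mul_pow (c := 2 ^ M) (by positivity) M) ?_ ?_
  · filter_upwards [eventually_gt_atTop 0] with ρ hρ
    simpa using h.le_selectionOutage (S ρ) hρ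
  · filter_upwards [eventually_gt_atTop 0] with ρ hρ
    rw [one_mul]
    exact (measureReal_mono fun ω hω => hS ρ hρ ω hω).trans (h.measureReal_pairGain_lt_le _)

theorem IsBestPair.forall_lt_threshold {ρ R : ℝ} (hρ : 0 < ρ) {x y : Fin M → ℂ} {i : Fin M}
    (hi : IsBestPair x y i) (hout : ¬ Supports ρ R (pairGain x y i)) (j : Fin M) :
    pairGain x y j < threshold ρ R :=
  (hi j).trans_lt ((not_supports_pairGain_iff hρ x y i).1 hout)

/-- One bit per destination suffices: a pair with `γ_i ≥ α` reports `1` and is detected by the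
relay, so that both links of the selected pair are above the threshold. -/
theorem RelayRule.forall_lt_threshold {Θ : Type*} {f : RelayRule M Θ} {ρ R : ℝ} (hρ : 0 < ρ)
    (hf : f.PicksBestEligible ∨ f.PicksSupported ρ R) (x y : Fin M → ℂ) (θ : Θ)
    (hout : ¬ Supports ρ R (pairGain x y (f (feedback (threshold ρ R) y) x θ))) (j : Fin M) :
    pairGain x y j < threshold ρ R := by
  by_contra! hj
  obtain ⟨hxj, hyj⟩ := le_min_iff.1 hj
  have hbj : feedback (threshold ρ R) y j = true := decide_eq_true hyj
  have hboth : feedback (threshold ρ R) y (f (feedback (threshold ρ R) y) x θ) = true ∧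
      threshold ρ R ≤ ‖x (f (feedback (threshold ρ R) y) x θ)‖ ^ 2 := by
    rcases hf with hf | hf
    · obtain ⟨h1, h2⟩ := hf _ x θ ⟨j, hbj⟩
      exact ⟨h1, hxj.trans (h2 j hbj)⟩
    · obtain ⟨h1, h2⟩ := hf _ x θ ⟨j, hbj, (supports_iff hρ (by positivity)).2 hxj⟩
      exact ⟨h1, (supports_iff hρ (by positivity)).1 h2⟩
  rw [not_supports_pairGain_iff hρ] at hout
  exact hout.not_ge (le_min hboth.2 (of_decide_eq_true hboth.1))

/-! ### Access without transmit CSI -/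

/-- Outage is no more likely than some link being below the threshold, and no less likely than one
given relay-destination link being so. -/
theorem noCSIOutage_orthogonal_hasDiversity (hM : 1 ≤ M) (hv : 0 < v)
    (h : IsGatewayFading P v hIn hOut) (hR : HasMultiplexingGain R r) (a : Access) :
    HasDiversity (fun ρ => noCSIOutage P hIn hOut a (orthogonalBCSupports ρ) ρ (R ρ))
      (max (1 - 2 * r) 0) := by
  have hM0 : (0 : ℝ) < M := by exact_mod_cast hM
  have hF := hR.hasDiversity_norm_sq_lt hv one_pos
  simp only [one_mul] at hF
  have hup := hF.const_mul_pow (c := 2 * M) (by positivity) 1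
  simp only [Nat.cast_one, one_mul, pow_one] at hup
  refine hF.squeeze hup ?_ ?_
  · filter_upwards [eventually_gt_atTop 0] with ρ hρ
    rw [← h.measureReal_lt (Sum.inr ⟨0, hM⟩)]
    refine measureReal_mono fun ω hω => Or.inr fun hbc => ?_
    have h0 := (le_orthogonal_rate_iff hM _ _ _).1 (hbc ⟨0, hM⟩)
    exact not_le_of_gt hω ((supports_iff hρ (by positivity)).1 h0)
  · filter_upwards [eventually_gt_atTop 0, hR.eventually_pos] with ρ hρ hRρ
    refine (measureReal_mono fun ω hω => ?_).trans (h.measureReal_exists_pairGain_lt_le _)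
    by_contra hcon
    have hgood : ∀ i, threshold ρ (R ρ) ≤ ‖hIn i ω‖ ^ 2 ∧ threshold ρ (R ρ) ≤ ‖hOut i ω‖ ^ 2 :=
      fun i => le_min_iff.1 (not_lt.1 fun hi => hcon ⟨i, hi⟩)
    rcases hω with hmac | hbc
    · exact hmac (macSupports_of_forall_threshold_le hM hρ hRρ.le (fun i => (hgood i).1) a)
    · exact hbc fun i => (le_orthogonal_rate_iff hM _ _ _).2
        ((supports_iff hρ (by positivity)).2 (hgood i).2)

/-- Some user, depending on the strategy only, is in outage whenever its own relay-destination
gain is below half the threshold. -/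
theorem noCSIOutage_diversityAtMost (hM : 1 ≤ M) (hv : 0 < v)
    (h : IsGatewayFading P v hIn hOut) (hR : HasMultiplexingGain R r) (a : Access)
    (B : ℝ → BroadcastStrategy M) (hB : ∀ ρ, 0 < ρ → (B ρ).avgPower ≤ ρ) :
    DiversityAtMost (fun ρ => noCSIOutage P hIn hOut a (B ρ).BCSupports ρ (R ρ))
      (max (1 - 2 * r) 0) := by
  refine (hR.hasDiversity_norm_sq_lt hv one_half_pos).diversityAtMost_of_le ?_
  filter_upwards [eventually_gt_atTop 0, hR.eventually_pos] with ρ hρ hRρ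
  have hτ := threshold_pos hρ hRρ
  obtain ⟨j, hj⟩ := (B ρ).exists_not_decodes hM (R := R ρ) (g := 1 / 2 * threshold ρ (R ρ)) hρ
    (hB ρ hρ) (by positivity) (by linarith)
  rw [← h.measureReal_lt (Sum.inr j)]
  exact measureReal_mono fun ω hω => Or.inr fun hbc =>
    hj _ (by positivity) (le_of_lt hω) (hbc j)

end Schemes

end Gateway

theorem mainTheorem9 {Ω : Type*} [MeasurableSpace Ω] (P : Measure Ω) [IsProbabilityMeasure P]
    {M : ℕ} (hM : 1 ≤ M) (v : ℝ≥0) (hv : 0 < v) (hIn hOut : Fin M → Ω → ℂ)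
    (hfading : Gateway.IsGatewayFading P v hIn hOut)
    (R : ℝ → ℝ) (r : ℝ) (hR : Gateway.HasMultiplexingGain R r) :
    -- upper bound for every opportunistic selection of one pair per transmission interval
    (∀ S : ℝ → Ω → Fin M,
      Gateway.DiversityAtMost (fun ρ => Gateway.selectionOutage P hIn hOut (S ρ) ρ (R ρ))
        (M * max (1 - 2 * r) 0)) ∧
    -- full CSI at the relay
    (∀ S : Ω → Fin M,
      (∀ ω, Gateway.IsBestPair (fun i => hIn i ω) (fun i => hOut i ω) (S ω)) →
      Gateway.HasDiversity (fun ρ => Gateway.selectionOutage P hIn hOut S ρ (R ρ))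
        (M * max (1 - 2 * r) 0)) ∧
    -- one-bit feedback, the relay picking the best or any suitable eligible pair
    (∀ (Θ : Type) (U : Ω → Θ) (f : ℝ → Gateway.RelayRule M Θ),
      ((∀ ρ, (f ρ).PicksBestEligible) ∨ (∀ ρ, (f ρ).PicksSupported ρ (R ρ))) →
      Gateway.HasDiversity (fun ρ => Gateway.oneBitOutage P hIn hOut U (f ρ) ρ (R ρ))
        (M * max (1 - 2 * r) 0)) ∧
    -- no transmit CSI: orthogonal broadcast, with either access of the sources
    (∀ a : Gateway.Access,
      Gateway.HasDiversity
        (fun ρ => Gateway.noCSIOutage P hIn hOut a (Gateway.orthogonalBCSupports ρ) ρ (R ρ))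
        (max (1 - 2 * r) 0)) ∧
    -- no transmit CSI: no relay strategy with power at most `ρ` does better
    (∀ (a : Gateway.Access) (B : ℝ → Gateway.BroadcastStrategy M),
      (∀ ρ, 0 < ρ → (B ρ).avgPower ≤ ρ) →
      Gateway.DiversityAtMost
        (fun ρ => Gateway.noCSIOutage P hIn hOut a (B ρ).BCSupports ρ (R ρ))
        (max (1 - 2 * r) 0)) := by
  refine ⟨fun S => Gateway.selectionOutage_diversityAtMost hv hfading hR S,
    fun S hS => Gateway.selectionOutage_hasDiversity hv hfading hR (fun _ => S)
      fun ρ hρ ω hout => (hS ω).forall_lt_threshold hρ hout,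
    fun Θ U f hf => Gateway.selectionOutage_hasDiversity hv hfading hR _
      fun ρ hρ ω hout => Gateway.RelayRule.forall_lt_threshold hρ
        (hf.imp (fun h => h ρ) fun h => h ρ) _ _ (U ω) hout,
    fun a => Gateway.noCSIOutage_orthogonal_hasDiversity hM hv hfading hR a,
    fun a B hB => Gateway.noCSIOutage_diversityAtMost hM hv hfading hR a B hB⟩
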